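/- Let $D=\{z\in\mathbb R^2: |z|<1\}$ and let $S^1$ be the unit circle. For $P,Q\in D$ let $$d'(P,Q)=d(G^{-1}(P),G^{-1}(Q)),\qquad d(X,Y)=\operatorname{arccosh}\Bigl(1+\frac{2|X-Y|^2}{(1-|X|^2)(1-|Y|^2)}\Bigr),\qquad G^{-1}(z)=\frac{z}{1+\sqrt{1-|z|^2}},$$ be the Beltrami–Klein distance. For $P\neq Q$ in $D$ and $R\in D$ put $$\Delta'(P,Q)=\log\frac{e^{d'(P,Q)}+1}{e^{d'(P,Q)}-1},$$ and let $\delta(P,Q,R)$ be the minimum of $d'(R,S)$ over the points $S\in D$ of the straight line $PQ$. Let $P,Q,R\in D$ be the vertices of a nondegenerate triangle. From each $v\in S^1$ there are exactly two chords $vv_1$, $vv_2$ with $v_1,v_2\in S^1\setminus\{v\}$ tangent to the triangle (they touch the filled triangle but do not meet its interior), where $v_1$ is the endpoint closer to $v$ in the counterclockwise direction. The map $\psi:S^1\to S^1$, $\psi(v)=v_1$, is a homeomorphism and has a continuous nondecreasing lift $\bar\psi:\mathbb R\to\mathbb R$ along $x\mapsto e^{2\pi i x}$ with $\bar\psi(x+1)=\bar\psi(x)+1$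 and $\bar\psi(0)\in(0,1)$. Let $\rho(\psi)=\lim_{n\to\infty}\bar\psi^{\,n}(0)/n$ be its rotation number. Then: - if $\delta(P,Q,R)<\Delta'(P,Q)$, then $\tfrac13<\rho(\psi)<\tfrac12$; - if $\delta(P,Q,R)\ge\Delta'(P,Q)$, then $\rho(\psi)=\tfrac13$. -/

import Mathlib

namespace BarBilliard

noncomputable section

/-! The plane `ℝ²` is modelled by `ℂ` (whose norm is the Euclidean norm), the disk by
`Metric.ball 0 1`, and the unit circle by `Circle`. -/

/-- The hyperbolic distance of the Poincaré disk. -/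
def poincareDist (P Q : ℂ) : ℝ :=
  Real.arcosh (1 + 2 * ‖P - Q‖ ^ 2 / ((1 - ‖P‖ ^ 2) * (1 - ‖Q‖ ^ 2)))

/-- The isomorphism `G` from the Poincaré disk to the Beltrami–Klein disk. -/
def poincareToKlein (z : ℂ) : ℂ := ((2 / (1 + ‖z‖ ^ 2) : ℝ) : ℂ) * z

/-- The inverse of `poincareToKlein`, from the Beltrami–Klein disk to the Poincaré disk. -/
def kleinToPoincare (z : ℂ) : ℂ := ((1 / (1 + √(1 - ‖z‖ ^ 2)) : ℝ) : ℂ) * z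

theorem poincareToKlein_kleinToPoincare {z : ℂ} (hz : ‖z‖ < 1) :
    poincareToKlein (kleinToPoincare z) = z := by
  have h0 : 0 ≤ 1 - ‖z‖ ^ 2 := by nlinarith [norm_nonneg z]
  have hs : √(1 - ‖z‖ ^ 2) ^ 2 = 1 - ‖z‖ ^ 2 := Real.sq_sqrt h0
  have hn : 0 ≤ √(1 - ‖z‖ ^ 2) := Real.sqrt_nonneg _
  unfold poincareToKlein kleinToPoincare
  rw [← mul_assoc, ← Complex.ofReal_mul, norm_mul, Complex.norm_real, Real.norm_eq_abs,
    mul_pow, sq_abs]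
  generalize √(1 - ‖z‖ ^ 2) = s at *
  have hz2 : ‖z‖ ^ 2 = 1 - s ^ 2 := by linarith
  rw [hz2]
  have h1 : (1 + s) ≠ 0 := by positivity
  have h2 : (1 : ℝ) + (1 / (1 + s)) ^ 2 * (1 - s ^ 2) = 2 / (1 + s) := by
    field_simp
    ring
  rw [h2]
  have h3 : 2 / (2 / (1 + s)) * (1 / (1 + s)) = 1 := by
    field_simp
  rw [h3]
  simp

/-- The Beltrami–Klein distance `d'`. -/
def kleinDist (P Q : ℂ) : ℝ := poincareDist (kleinToPoincare P) (kleinToPoincare Q)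

/-- `Δ'(P, Q) = log ((e^{d'(P,Q)} + 1) / (e^{d'(P,Q)} - 1))`. -/
def DeltaKlein (P Q : ℂ) : ℝ :=
  Real.log ((Real.exp (kleinDist P Q) + 1) / (Real.exp (kleinDist P Q) - 1))

/-- `δ(P, Q, R)`: the least (the infimum is attained) Beltrami–Klein distance from `R` to a point of the hyperbolic line
`PQ`, that is, of the part of the straight line `PQ` inside the disk. -/
def deltaKlein (P Q R : ℂ) : ℝ :=
  sInf (kleinDist R '' {S : ℂ | S ∈ line[ℝ, P, Q] ∧ S ∈ Metric.ball (0 : ℂ) 1})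

/-- The (filled) triangle `PQR`. -/
def triangle (P Q R : ℂ) : Set ℂ := convexHull ℝ {P, Q, R}

/-- The chord from `v` to `u` is tangent to the triangle: it touches the triangle without
meeting its interior. -/
def IsTangentChord (P Q R : ℂ) (v u : Circle) : Prop :=
  u ≠ v ∧ (segment ℝ (v : ℂ) u ∩ triangle P Q R).Nonempty ∧
    Disjoint (segment ℝ (v : ℂ) u) (interior (triangle P Q R))

/-- The length, in turns and lying in `[0, 1)`, of the counterclockwise arc from `v` to `w`. -/
def ccwDist (v w : Circle) : ℝ := Int.fract (Complex.arg ((w / v : Circle) : ℂ) / (2 * Real.pi))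

/-- There are exactly two tangent chords to the triangle from `v`, and `w` is the endpoint which
is closer to `v` in the counterclockwise direction. -/
def IsCcwTangentPoint (P Q R : ℂ) (v w : Circle) : Prop :=
  ∃ w' : Circle, {u : Circle | IsTangentChord P Q R v u} = {w, w'} ∧ ccwDist v w < ccwDist v w'

theorem IsCcwTangentPoint.unique {P Q R : ℂ} {v w₁ w₂ : Circle}
    (h₁ : IsCcwTangentPoint P Q R v w₁) (h₂ : IsCcwTangentPoint P Q R v w₂) : w₁ = w₂ := by
  obtain ⟨u₁, e₁, l₁⟩ := h₁
  obtain ⟨u₂, e₂, l₂⟩ := h₂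
  have a : w₁ ∈ ({w₂, u₂} : Set Circle) := by rw [← e₂, e₁]; simp
  have b : w₂ ∈ ({w₁, u₁} : Set Circle) := by rw [← e₁, e₂]; simp
  rcases a with a | a
  · exact a
  · rcases b with b | b
    · exact b.symm
    · have a' : w₁ = u₂ := a
      have b' : w₂ = u₁ := b
      rw [← b'] at l₁
      rw [← a'] at l₂
      exact absurd l₁ l₂.not_gt

/-- The bar billiard map `ψ` of the triangle `PQR`. -/
def barBilliard (P Q R : ℂ) (v : Circle) : Circle :=
  Classical.epsilon (IsCcwTangentPoint P Q R v)

/-- `F` is the continuous lift of `f` along `x ↦ exp (2πix)` with `F 0 ∈ (0, 1)`. A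
`CircleDeg1Lift` is a monotone map of the real line commuting with `x ↦ x + 1`. -/
structure IsNormalizedLift (F : CircleDeg1Lift) (f : Circle → Circle) : Prop where
  continuous : Continuous F
  lifts : ∀ x : ℝ, f (Circle.exp (2 * Real.pi * x)) = Circle.exp (2 * Real.pi * F x)
  zero_mem : F 0 ∈ Set.Ioo (0 : ℝ) 1

theorem IsNormalizedLift.unique {F₁ F₂ : CircleDeg1Lift} {f : Circle → Circle}
    (h₁ : IsNormalizedLift F₁ f) (h₂ : IsNormalizedLift F₂ f) : F₁ = F₂ := by
  have key : ∀ x, ∃ m : ℤ, F₁ x - F₂ x = m := by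
    intro x
    have h := (h₁.lifts x).symm.trans (h₂.lifts x)
    obtain ⟨m, hm⟩ := Circle.exp_eq_exp.mp h
    refine ⟨m, ?_⟩
    have hp : (2 * Real.pi) ≠ 0 := by positivity
    apply mul_left_cancel₀ hp
    linarith
  choose m hm using key
  have hmc : Continuous m := by
    rw [Int.isClosedEmbedding_coe_real.continuous_iff]
    have : ((fun n : ℤ => (n : ℝ)) ∘ m) = fun x => F₁ x - F₂ x := by
      funext x
      exact (hm x).symm
    rw [this]
    exact h₁.continuous.sub h₂.continuous
  have h0 : m 0 = 0 := by
    have a := h₁.zero_mem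
    have b := h₂.zero_mem
    have c := hm 0
    have d : (m 0 : ℝ) < 1 := by linarith [a.2, b.1]
    have e : (-1 : ℝ) < m 0 := by linarith [a.1, b.2]
    have d' : m 0 < 1 := by exact_mod_cast d
    have e' : -1 < m 0 := by exact_mod_cast e
    omega
  ext x
  have hx : m x = m 0 := PreconnectedSpace.constant inferInstance hmc
  have := hm x
  rw [hx, h0] at this
  push_cast at this
  linarith

open Classical in
/-- The rotation number `lim F^n(0) / n`, where `F` is the normalized lift of `f`; it is set to
`0` if there is no such lift. -/
def rotationNumber (f : Circle → Circle) : ℝ :=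
  if h : ∃ F : CircleDeg1Lift, IsNormalizedLift F f then h.choose.translationNumber else 0

theorem IsNormalizedLift.rotationNumber_eq {F : CircleDeg1Lift} {f : Circle → Circle}
    (h : IsNormalizedLift F f) : rotationNumber f = F.translationNumber := by
  have hex : ∃ F : CircleDeg1Lift, IsNormalizedLift F f := ⟨F, h⟩
  rw [rotationNumber, dif_pos hex, hex.choose_spec.unique h]

end

end BarBilliard

/-!
Parametrize the circle by turns, `turn x = exp (2πix)`. For a point `P` of the disk, sending an
endpoint of a chord through `P` to the other one is the action on the circle of the half-turn of
the hyperbolic plane about `P`. It has a lift `chordLift P`, which is increasing, lies strictly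
between `x` and `x + 1`, and satisfies `chordLift P (chordLift P x) = x + 1`. The tangent chords
from `turn x` end at the least and the greatest of the values at `x` of the three lifts that belong
to the vertices (`isTangentChord_turn_iff`); hence the minimum `tangentLift P Q R` of these lifts
is the lift of the bar billiard map, and the third iterate of `tangentLift P Q R` is the smallest
one among all compositions of three of the lifts `chordLift P`, `chordLift Q`, `chordLift R`.

* The second iterate stays below `x + 1`, since not all three vertices lie on the tangent chord;
  so the rotation number is less than `1 / 2`.
* A composition of three lifts in which a vertex is repeated exceeds `x + 1`
  (`add_one_lt_chordLift_three`). The orbit that starts along the side `PQ` can be read as one with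
  a repeated vertex, so the rotation number is at least `1 / 3`. By the intermediate value theorem
  it is greater than `1 / 3`, unless the third iterate takes the value `x + 1` somewhere, which
  forces a composition of the half-turns about the three distinct vertices to fix a point of the
  circle.
* Conversely, if such a composition has a fixed point, its lift takes the value `x + 1` or `x + 2`
  there. In the second case the lift of the inverse, the composition in the opposite order, takes
  the value `y + 1` somewhere. Either way the third iterate is at most `x + 1` somewhere, and the
  rotation number is at most `1 / 3` (`translationNumber_le_one_third`).

A product of three half-turns is an orientation preserving isometry, whose matrix in `SU(1, 1)` has
half-trace `± det(p, q, r)`, where `p`, `q`, `r` are the unit vectors of the vertices in the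
hyperboloid model. It has a fixed point on the circle iff `|det(p, q, r)| ≥ 1`. Finally
`|det(p, q, r)| = sinh (d'(P, Q)) sinh (δ(P, Q, R))` and `sinh Δ' = 1 / sinh d'`, which turns this
condition into `δ ≥ Δ'` (`deltaKlein_lt_DeltaKlein_iff`).
-/

namespace BarBilliard

open Complex ComplexConjugate

noncomputable section

/-! ### The circle parametrized by turns -/

/-- The point of the unit circle at `x` turns. -/
def turn (x : ℝ) : Circle := Circle.exp (2 * Real.pi * x)

theorem coe_turn (x : ℝ) : (turn x : ℂ) = Complex.exp ((2 * Real.pi * x : ℝ) * I) := by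
  simp [turn, Circle.coe_exp]

theorem continuous_turn : Continuous turn := by
  unfold turn; fun_prop

theorem turn_add (x y : ℝ) : turn (x + y) = turn x * turn y := by
  simp [turn, mul_add, Circle.exp_add]

theorem turn_eq_turn_iff {x y : ℝ} : turn x = turn y ↔ ∃ m : ℤ, x = y + m := by
  unfold turn
  rw [Circle.exp_eq_exp]
  have hp : (2 * Real.pi) ≠ 0 := by positivity
  refine exists_congr fun m => ⟨fun h => mul_left_cancel₀ hp ?_, fun h => ?_⟩
  · linarith
  · rw [h]; ring

theorem turn_add_intCast (x : ℝ) (m : ℤ) : turn (x + m) = turn x :=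
  turn_eq_turn_iff.2 ⟨m, rfl⟩

theorem turn_add_one (x : ℝ) : turn (x + 1) = turn x := by
  simpa using turn_add_intCast x 1

theorem coe_turn_add_half (x : ℝ) : (turn (x + 1 / 2) : ℂ) = -turn x := by
  rw [coe_turn, coe_turn]
  have : ((2 * Real.pi * (x + 1 / 2) : ℝ) : ℂ) * I = (2 * Real.pi * x : ℝ) * I + Real.pi * I := by
    push_cast; ring
  rw [this, Complex.exp_add, Complex.exp_pi_mul_I]; ring

theorem turn_surjective : Function.Surjective turn := by
  intro v
  refine ⟨arg (v : ℂ) / (2 * Real.pi), ?_⟩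
  unfold turn
  rw [mul_div_cancel₀ _ (by positivity : (2 * Real.pi) ≠ 0), Circle.exp_arg]

theorem exists_turn_eq (x : ℝ) (u : Circle) : ∃ y, x ≤ y ∧ y < x + 1 ∧ turn y = u := by
  obtain ⟨y, rfl⟩ := turn_surjective u
  refine ⟨y - ⌊y - x⌋, ?_, ?_, turn_eq_turn_iff.2 ⟨-⌊y - x⌋, by push_cast; ring⟩⟩
  · linarith [Int.floor_le (y - x)]
  · linarith [Int.lt_floor_add_one (y - x)]

theorem turn_ne_turn {x y : ℝ} (h₁ : x < y) (h₂ : y < x + 1) : turn y ≠ turn x := by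
  intro h
  obtain ⟨m, hm⟩ := turn_eq_turn_iff.1 h
  have h3 : (0 : ℝ) < m := by linarith
  have h4 : (m : ℝ) < 1 := by linarith
  have h5 : 0 < m := by exact_mod_cast h3
  have h6 : m < 1 := by exact_mod_cast h4
  omega

theorem turn_mul_conj (x : ℝ) : (turn x : ℂ) * conj (turn x : ℂ) = 1 := by
  rw [Complex.mul_conj, Circle.normSq_coe]; simp

theorem ccwDist_turn {x y : ℝ} (h₁ : x ≤ y) (h₂ : y < x + 1) :
    ccwDist (turn x) (turn y) = y - x := by
  have hq : turn y / turn x = turn (y - x) := by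
    rw [div_eq_iff_eq_mul, ← turn_add]; simp
  unfold ccwDist
  rw [hq]
  have h : turn (arg (turn (y - x) : ℂ) / (2 * Real.pi)) = turn (y - x) := by
    rw [turn, mul_div_cancel₀ _ (by positivity : (2 * Real.pi) ≠ 0), Circle.exp_arg]
  obtain ⟨m, hm⟩ := turn_eq_turn_iff.1 h
  rw [hm, Int.fract_add_intCast, Int.fract_eq_self]
  constructor <;> linarith

/-! ### Chords through a point of the disk -/

/-- For a point `P` of the disk, `turn (chordLift P x)` is the second endpoint of the chord from
`turn x` through `P`; the lift is normalized to take values between `x` and `x + 1`. -/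
def chordLift (P : ℂ) (x : ℝ) : ℝ :=
  x + 1 / 2 + arg (1 - P * conj (turn x : ℂ)) / Real.pi

section chordLift

variable {P : ℂ}

theorem re_one_sub_pos (hP : ‖P‖ < 1) (x : ℝ) : 0 < (1 - P * conj (turn x : ℂ)).re := by
  have h : (P * conj (turn x : ℂ)).re ≤ ‖P‖ := by
    refine (Complex.re_le_norm _).trans ?_
    rw [norm_mul, RCLike.norm_conj, Circle.norm_coe, mul_one]
  simp only [sub_re, one_re]
  linarith

theorem one_sub_ne_zero (hP : ‖P‖ < 1) (x : ℝ) : 1 - P * conj (turn x : ℂ) ≠ 0 := by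
  intro h
  have := re_one_sub_pos hP x
  simp [h] at this

theorem lt_chordLift (hP : ‖P‖ < 1) (x : ℝ) : x < chordLift P x := by
  have h := (abs_lt.1 (Complex.abs_arg_lt_pi_div_two_iff.2 (Or.inl (re_one_sub_pos hP x)))).1
  have h2 : -(1 / 2) < arg (1 - P * conj (turn x : ℂ)) / Real.pi := by
    rw [lt_div_iff₀ Real.pi_pos]; linarith
  unfold chordLift; linarith

theorem chordLift_lt (hP : ‖P‖ < 1) (x : ℝ) : chordLift P x < x + 1 := by
  have h := (abs_lt.1 (Complex.abs_arg_lt_pi_div_two_iff.2 (Or.inl (re_one_sub_pos hP x)))).2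
  have h2 : arg (1 - P * conj (turn x : ℂ)) / Real.pi < 1 / 2 := by
    rw [div_lt_iff₀ Real.pi_pos]; linarith
  unfold chordLift; linarith

theorem continuous_chordLift (hP : ‖P‖ < 1) : Continuous (chordLift P) := by
  unfold chordLift
  refine (by fun_prop : Continuous fun x : ℝ => x + 1 / 2).add (Continuous.div_const ?_ _)
  rw [continuous_iff_continuousAt]
  intro x
  have hc : Continuous fun x => 1 - P * conj (turn x : ℂ) := by
    have := continuous_turn
    fun_prop
  exact (Complex.continuousAt_arg (Or.inl (re_one_sub_pos hP x))).comp
    (f := fun x => 1 - P * conj (turn x : ℂ)) hc.continuousAt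

theorem chordLift_add_one (x : ℝ) : chordLift P (x + 1) = chordLift P x + 1 := by
  unfold chordLift
  rw [turn_add_one]; ring

/-- An affine function of `z` which vanishes on the chord from `turn x` to `turn y`, and is
positive on the side of the arc running counterclockwise from `turn x` to `turn y`. -/
def chordSide (x y : ℝ) (z : ℂ) : ℝ :=
  (z * conj (turn ((x + y) / 2) : ℂ)).re - Real.cos (Real.pi * (y - x))

theorem chordSide_add_one (x y : ℝ) (z : ℂ) : chordSide y (x + 1) z = -chordSide x y z := by
  unfold chordSide
  have h : (y + (x + 1)) / 2 = (x + y) / 2 + 1 / 2 := by ring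
  have h2 : Real.pi * (x + 1 - y) = Real.pi - Real.pi * (y - x) := by ring
  rw [h, coe_turn_add_half, h2, Real.cos_pi_sub]
  simp only [map_neg, mul_neg, neg_re]
  ring

theorem turn_mul_conj_turn (x y : ℝ) :
    (turn x : ℂ) * conj (turn y : ℂ) = Complex.exp ((2 * Real.pi * (x - y) : ℝ) * I) := by
  rw [coe_turn, coe_turn, ← Complex.exp_conj, ← Complex.exp_add]
  congr 1
  simp only [map_mul, conj_ofReal, conj_I]
  push_cast
  ring

/-- The side of the chord on which `P` lies is decided by comparing `y` with `chordLift P x`. -/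
theorem chordSide_eq (x y : ℝ) :
    chordSide x y P =
      ‖1 - P * conj (turn x : ℂ)‖ * Real.sin (Real.pi * (y - chordLift P x)) := by
  set w := 1 - P * conj (turn x : ℂ) with hw
  have hP : P = turn x * (1 - w) := by
    rw [hw]
    linear_combination -P * turn_mul_conj x
  have h1 : P * conj (turn ((x + y) / 2) : ℂ) =
      Complex.exp ((-(Real.pi * (y - x)) : ℝ) * I)
        - ‖w‖ * Complex.exp ((arg w - Real.pi * (y - x) : ℝ) * I) := by
    have h2 := turn_mul_conj_turn x ((x + y) / 2)
    have h3 : ((arg w - Real.pi * (y - x) : ℝ) : ℂ) * I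
        = arg w * I + ((-(Real.pi * (y - x)) : ℝ) : ℂ) * I := by
      push_cast; ring
    have h4 : 2 * Real.pi * (x - (x + y) / 2) = -(Real.pi * (y - x)) := by ring
    rw [h4] at h2
    rw [h3, Complex.exp_add, ← mul_assoc, Complex.norm_mul_exp_arg_mul_I, ← h2]
    conv_lhs => rw [hP]
    ring
  have h5 : Real.pi * (y - chordLift P x) = Real.pi / 2 - Real.pi
      + (Real.pi * (y - x) - arg w) := by
    unfold chordLift
    rw [← hw]
    field_simp
    ring
  unfold chordSide
  rw [h1, Complex.sub_re, Complex.re_ofReal_mul, Complex.exp_ofReal_mul_I_re,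
    Complex.exp_ofReal_mul_I_re, h5, Real.cos_neg,
    show Real.pi / 2 - Real.pi + (Real.pi * (y - x) - arg w)
      = -(Real.pi / 2 - (Real.pi * (y - x) - arg w)) by ring, Real.sin_neg,
    Real.sin_pi_div_two_sub, ← Real.cos_neg (arg w - _)]
  ring_nf

theorem chordSide_pos_iff (hP : ‖P‖ < 1) {x y : ℝ} (h₁ : x < y) (h₂ : y < x + 1) :
    0 < chordSide x y P ↔ chordLift P x < y := by
  have hn : 0 < ‖1 - P * conj (turn x : ℂ)‖ := norm_pos_iff.2 (one_sub_ne_zero hP x)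
  have a := lt_chordLift hP x
  have b := chordLift_lt hP x
  rw [chordSide_eq, mul_pos_iff_of_pos_left hn]
  have hpi := Real.pi_pos
  constructor
  · intro h
    by_contra! hle
    refine absurd h (not_lt.2 (Real.sin_nonpos_of_nonpos_of_neg_pi_le ?_ ?_)) <;> nlinarith
  · intro h
    apply Real.sin_pos_of_pos_of_lt_pi <;> nlinarith

theorem chordSide_neg_iff (hP : ‖P‖ < 1) {x y : ℝ} (h₁ : x < y) (h₂ : y < x + 1) :
    chordSide x y P < 0 ↔ y < chordLift P x := by
  have hn : 0 < ‖1 - P * conj (turn x : ℂ)‖ := norm_pos_iff.2 (one_sub_ne_zero hP x)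
  have a := lt_chordLift hP x
  have b := chordLift_lt hP x
  have hpi := Real.pi_pos
  rw [chordSide_eq, ← neg_pos, ← mul_neg, mul_pos_iff_of_pos_left hn, neg_pos]
  constructor
  · intro h
    by_contra! hle
    refine absurd h (not_lt.2 (Real.sin_nonneg_of_nonneg_of_le_pi ?_ ?_)) <;> nlinarith
  · intro h
    apply Real.sin_neg_of_neg_of_neg_pi_lt <;> nlinarith

theorem chordSide_eq_zero_iff (hP : ‖P‖ < 1) {x y : ℝ} (h₁ : x < y) (h₂ : y < x + 1) :
    chordSide x y P = 0 ↔ chordLift P x = y := by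
  have a := chordSide_pos_iff hP h₁ h₂
  have b := chordSide_neg_iff hP h₁ h₂
  constructor
  · intro h
    rw [h] at a b
    exact le_antisymm (not_lt.1 fun h' => lt_irrefl _ (b.2 h'))
      (not_lt.1 fun h' => lt_irrefl _ (a.2 h'))
  · intro h
    rw [h] at a b
    exact le_antisymm (not_lt.1 fun h' => lt_irrefl _ (a.1 h'))
      (not_lt.1 fun h' => lt_irrefl _ (b.1 h'))

theorem chordLift_chordLift (hP : ‖P‖ < 1) (x : ℝ) : chordLift P (chordLift P x) = x + 1 := by
  have a := lt_chordLift hP x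
  have b := chordLift_lt hP x
  rw [← chordSide_eq_zero_iff hP b (by linarith), chordSide_add_one, neg_eq_zero,
    chordSide_eq_zero_iff hP a b]

theorem strictMono_chordLift (hP : ‖P‖ < 1) : StrictMono (chordLift P) := by
  have hinj : Function.Injective (chordLift P) := by
    intro x y h
    have := congrArg (chordLift P) h
    rw [chordLift_chordLift hP, chordLift_chordLift hP] at this
    linarith
  rcases (continuous_chordLift hP).strictMono_of_inj hinj with h | h
  · exact h
  · have h1 := h (show (0 : ℝ) < 0 + 1 by norm_num)
    rw [chordLift_add_one] at h1
    linarith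

/-- The second endpoint of a chord through `P` is given by a Möbius transformation. -/
theorem turn_chordLift_mul (x : ℝ) :
    (turn (chordLift P x) : ℂ) * (1 - conj P * turn x) = P - turn x := by
  set w := 1 - P * conj (turn x : ℂ) with hw
  have h1 : (turn (chordLift P x) : ℂ) = -(turn x * Complex.exp (2 * arg w * I)) := by
    have h2 : chordLift P x = x + arg w / Real.pi + 1 / 2 := by
      unfold chordLift; ring
    rw [h2, coe_turn_add_half, coe_turn, coe_turn, ← Complex.exp_add]
    congr 2
    push_cast
    have : (Real.pi : ℂ) ≠ 0 := by exact_mod_cast Real.pi_ne_zero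
    field_simp
  have h3 : Complex.exp (2 * arg w * I) * conj w = w := by
    have h4 : conj w = ‖w‖ * Complex.exp (-(arg w * I)) := by
      conv_lhs => rw [← Complex.norm_mul_exp_arg_mul_I w]
      rw [map_mul, ← Complex.exp_conj]
      simp only [map_mul, conj_ofReal, conj_I]
      ring_nf
    rw [h4, mul_left_comm, ← Complex.exp_add]
    conv_rhs => rw [← Complex.norm_mul_exp_arg_mul_I w]
    congr 2
    ring
  have h4 : conj w = 1 - conj P * turn x := by simp [hw]
  rw [← h4, h1]
  have h5 := turn_mul_conj x
  linear_combination (-(turn x : ℂ)) * h3 - turn x * hw + P * h5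

end chordLift

/-! ### Tangent chords -/

section chordSide

variable {x y : ℝ} {z : ℂ}

theorem isLinearMap_re_mul (c : ℂ) : IsLinearMap ℝ fun z : ℂ => (z * c).re where
  map_add z w := by simp [add_mul]
  map_smul r z := by simp [mul_assoc, mul_sub]

theorem convex_chordSide_neg (x y : ℝ) : Convex ℝ {z | chordSide x y z < 0} := by
  simpa [chordSide, sub_neg] using convex_halfSpace_lt
    (isLinearMap_re_mul (conj (turn ((x + y) / 2) : ℂ))) (Real.cos (Real.pi * (y - x)))

theorem convex_chordSide_pos (x y : ℝ) : Convex ℝ {z | 0 < chordSide x y z} := by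
  simpa [chordSide, sub_pos] using convex_halfSpace_gt
    (isLinearMap_re_mul (conj (turn ((x + y) / 2) : ℂ))) (Real.cos (Real.pi * (y - x)))

theorem convex_chordSide_nonpos (x y : ℝ) : Convex ℝ {z | chordSide x y z ≤ 0} := by
  simpa [chordSide, sub_nonpos] using convex_halfSpace_le
    (isLinearMap_re_mul (conj (turn ((x + y) / 2) : ℂ))) (Real.cos (Real.pi * (y - x)))

theorem convex_chordSide_nonneg (x y : ℝ) : Convex ℝ {z | 0 ≤ chordSide x y z} := by
  simpa [chordSide, sub_nonneg] using convex_halfSpace_ge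
    (isLinearMap_re_mul (conj (turn ((x + y) / 2) : ℂ))) (Real.cos (Real.pi * (y - x)))

theorem continuous_chordSide (x y : ℝ) : Continuous (chordSide x y) := by
  unfold chordSide; fun_prop

theorem chordSide_left (x y : ℝ) : chordSide x y (turn x) = 0 := by
  rw [chordSide, turn_mul_conj_turn, Complex.exp_ofReal_mul_I_re, sub_eq_zero, ← Real.cos_neg]
  ring_nf

theorem chordSide_right (x y : ℝ) : chordSide x y (turn y) = 0 := by
  rw [chordSide, turn_mul_conj_turn, Complex.exp_ofReal_mul_I_re, sub_eq_zero]
  ring_nf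

theorem chordSide_eq_zero_of_mem_segment (h : z ∈ segment ℝ (turn x : ℂ) (turn y)) :
    chordSide x y z = 0 := by
  apply le_antisymm
  · exact (convex_chordSide_nonpos x y).segment_subset (chordSide_left x y).le
      (chordSide_right x y).le h
  · exact (convex_chordSide_nonneg x y).segment_subset (chordSide_left x y).ge
      (chordSide_right x y).ge h

theorem mem_segment_of_chordSide_eq_zero (h₁ : x < y) (h₂ : y < x + 1) (hz : ‖z‖ ≤ 1)
    (h : chordSide x y z = 0) : z ∈ segment ℝ (turn x : ℂ) (turn y) := by
  set c : ℂ := ((turn ((x + y) / 2) : Circle) : ℂ) with hc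
  set θ := Real.pi * (y - x) with hθ
  have hpi := Real.pi_pos
  have hs : 0 < Real.sin θ := Real.sin_pos_of_pos_of_lt_pi (by nlinarith) (by nlinarith)
  have hcc : c * conj c = 1 := turn_mul_conj _
  set t := (z * conj c).im with ht
  have hre : (z * conj c).re = Real.cos θ := by
    have : (z * conj c).re - Real.cos θ = 0 := h
    linarith
  have hnorm : Real.cos θ ^ 2 + t ^ 2 ≤ 1 := by
    have h1 : ‖z * conj c‖ ≤ 1 := by
      rw [norm_mul, RCLike.norm_conj, hc, Circle.norm_coe, mul_one]; exact hz
    have h2 := Complex.sq_norm (z * conj c)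
    rw [Complex.normSq_apply, hre, ← ht] at h2
    nlinarith [norm_nonneg (z * conj c)]
  have hts : t ^ 2 ≤ Real.sin θ ^ 2 := by nlinarith [Real.sin_sq_add_cos_sq θ]
  obtain ⟨ht1, ht2⟩ := abs_le.1 (abs_le_of_sq_le_sq hts hs.le)
  have hx : (turn x : ℂ) = (Real.cos θ - Real.sin θ * I) * c := by
    have h3 := turn_mul_conj_turn x ((x + y) / 2)
    rw [show 2 * Real.pi * (x - (x + y) / 2) = -θ by rw [hθ]; ring, Complex.exp_mul_I,
      ← Complex.ofReal_cos, ← Complex.ofReal_sin, Real.cos_neg, Real.sin_neg] at h3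
    push_cast at h3 ⊢
    linear_combination c * h3 - turn x * hcc
  have hy : (turn y : ℂ) = (Real.cos θ + Real.sin θ * I) * c := by
    have h3 := turn_mul_conj_turn y ((x + y) / 2)
    rw [show 2 * Real.pi * (y - (x + y) / 2) = θ by rw [hθ]; ring, Complex.exp_mul_I,
      ← Complex.ofReal_cos, ← Complex.ofReal_sin] at h3
    linear_combination c * h3 - turn y * hcc
  have hz' : z = (Real.cos θ + t * I) * c := by
    have h3 : z * conj c = Real.cos θ + t * I := by
      rw [← hre, ht, Complex.re_add_im]
    linear_combination c * h3 - z * hcc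
  refine ⟨(1 - t / Real.sin θ) / 2, (1 + t / Real.sin θ) / 2, ?_, ?_, by ring, ?_⟩
  · have : t / Real.sin θ ≤ 1 := (div_le_one hs).2 ht2
    linarith
  · have : -1 ≤ t / Real.sin θ := by rw [le_div_iff₀ hs]; linarith
    linarith
  · have hs' : (Real.sin θ : ℂ) ≠ 0 := by exact_mod_cast hs.ne'
    rw [hx, hy, hz', Complex.real_smul, Complex.real_smul]
    push_cast [-ofReal_sin, -ofReal_cos]
    field_simp
    ring

theorem chordSide_add_smul (r : ℝ) :
    chordSide x y (z + r * turn ((x + y) / 2)) = chordSide x y z + r := by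
  have h : (z + r * turn ((x + y) / 2)) * conj (turn ((x + y) / 2) : ℂ)
      = z * conj (turn ((x + y) / 2) : ℂ) + r := by
    linear_combination (r : ℂ) * turn_mul_conj ((x + y) / 2)
  unfold chordSide
  rw [h, add_re, ofReal_re]
  ring

theorem exists_add_smul_mem {T : Set ℂ} (hz : z ∈ interior T) (c : Circle) :
    ∃ r : ℝ, 0 < r ∧ z + r * c ∈ T ∧ z + (-r : ℝ) * c ∈ T := by
  obtain ⟨ε, hε, hb⟩ := Metric.mem_nhds_iff.1 (mem_interior_iff_mem_nhds.1 hz)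
  have hd : ∀ r : ℝ, |r| = ε / 2 → z + r * c ∈ T := fun r hr => hb <| by
    rw [Metric.mem_ball, dist_eq_norm, add_sub_cancel_left, norm_mul, Circle.norm_coe, mul_one,
      Complex.norm_real, Real.norm_eq_abs, hr]
    linarith
  have h2 : |ε / 2| = ε / 2 := abs_of_pos (by positivity)
  exact ⟨ε / 2, by positivity, hd _ h2, hd _ (by rw [abs_neg, h2])⟩

theorem chordSide_neg_of_mem_interior {T : Set ℂ} (hT : T ⊆ {z | chordSide x y z ≤ 0})
    (hz : z ∈ interior T) : chordSide x y z < 0 := by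
  obtain ⟨r, hr, h, -⟩ := exists_add_smul_mem hz (turn ((x + y) / 2))
  have := hT h
  rw [Set.mem_ofPred_eq, chordSide_add_smul] at this
  linarith

theorem chordSide_pos_of_mem_interior {T : Set ℂ} (hT : T ⊆ {z | 0 ≤ chordSide x y z})
    (hz : z ∈ interior T) : 0 < chordSide x y z := by
  obtain ⟨r, hr, -, h⟩ := exists_add_smul_mem hz (turn ((x + y) / 2))
  have := hT h
  rw [Set.mem_ofPred_eq, chordSide_add_smul] at this
  linarith

/-- A line separating two points of a convex set with nonempty interior meets the interior. -/
theorem exists_mem_interior_chordSide_eq_zero {T : Set ℂ} (hT : Convex ℝ T)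
    (hi : (interior T).Nonempty) {A B : ℂ} (hA : A ∈ T) (hB : B ∈ T)
    (hA0 : 0 < chordSide x y A) (hB0 : chordSide x y B < 0) :
    ∃ z ∈ interior T, chordSide x y z = 0 := by
  have hcl : T ⊆ closure (interior T) := by
    rw [hT.closure_interior_eq_closure_of_nonempty_interior hi]; exact subset_closure
  have hc := continuous_chordSide x y
  obtain ⟨a, ha, ha'⟩ := mem_closure_iff.1 (hcl hA) _ (isOpen_lt continuous_const hc) hA0
  obtain ⟨b, hb, hb'⟩ := mem_closure_iff.1 (hcl hB) _ (isOpen_lt hc continuous_const) hB0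
  obtain ⟨z, hz, hz0⟩ := hT.interior.isPreconnected.intermediate_value hb' ha' hc.continuousOn
    (show (0 : ℝ) ∈ Set.Icc _ _ from ⟨le_of_lt hb, le_of_lt ha⟩)
  exact ⟨z, hz, hz0⟩

end chordSide

section tangent

variable {P Q R : ℂ} {x y m M : ℝ}

theorem interior_triangle_nonempty (h : AffineIndependent ℝ ![P, Q, R]) :
    (interior (triangle P Q R)).Nonempty := by
  have h2 : affineSpan ℝ (Set.range ![P, Q, R]) = ⊤ := by
    rw [h.affineSpan_eq_top_iff_card_eq_finrank_add_one, Complex.finrank_real_complex]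
    simp
  have h3 : Set.range ![P, Q, R] = {P, Q, R} := by
    rw [Matrix.range_cons, Matrix.range_cons_cons_empty]
    rfl
  rw [triangle, interior_convexHull_nonempty_iff_affineSpan_eq_top, ← h3, h2]

theorem triangle_subset_ball (hV : ∀ X ∈ ({P, Q, R} : Set ℂ), ‖X‖ < 1) :
    triangle P Q R ⊆ Metric.ball 0 1 :=
  convexHull_min (fun X hX => by simpa using hV X hX) (convex_ball _ _)

theorem isTangentChord_turn_iff (hV : ∀ X ∈ ({P, Q, R} : Set ℂ), ‖X‖ < 1)
    (hi : (interior (triangle P Q R)).Nonempty)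
    (hm : IsLeast ((fun X => chordLift X x) '' {P, Q, R}) m)
    (hM : IsGreatest ((fun X => chordLift X x) '' {P, Q, R}) M) (h₁ : x < y) (h₂ : y < x + 1) :
    IsTangentChord P Q R (turn x) (turn y) ↔ y = m ∨ y = M := by
  obtain ⟨⟨A, hA, rfl⟩, hmin⟩ := hm
  obtain ⟨⟨B, hB, rfl⟩, hmax⟩ := hM
  have hT : Convex ℝ (triangle P Q R) := convex_convexHull _ _
  have hsub : {P, Q, R} ⊆ triangle P Q R := subset_convexHull _ _
  have hmin' : ∀ X ∈ ({P, Q, R} : Set ℂ), chordLift A x ≤ chordLift X x :=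
    fun X hX => hmin ⟨X, hX, rfl⟩
  have hmax' : ∀ X ∈ ({P, Q, R} : Set ℂ), chordLift X x ≤ chordLift B x :=
    fun X hX => hmax ⟨X, hX, rfl⟩
  have hon : ∀ X ∈ ({P, Q, R} : Set ℂ), y = chordLift X x →
      (segment ℝ (turn x : ℂ) (turn y) ∩ triangle P Q R).Nonempty := fun X hX h =>
    ⟨X, mem_segment_of_chordSide_eq_zero h₁ h₂ (hV X hX).le
      ((chordSide_eq_zero_iff (hV X hX) h₁ h₂).2 h.symm), hsub hX⟩
  constructor
  · rintro ⟨-, ⟨z, hz, hzT⟩, hdisj⟩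
    have hz0 := chordSide_eq_zero_of_mem_segment hz
    have hle : chordLift A x ≤ y := by
      by_contra! hlt
      have : triangle P Q R ⊆ {z | chordSide x y z < 0} := convexHull_min
        (fun X hX => (chordSide_neg_iff (hV X hX) h₁ h₂).2 (hlt.trans_le (hmin' X hX)))
        (convex_chordSide_neg x y)
      exact (this hzT).ne hz0
    have hge : y ≤ chordLift B x := by
      by_contra! hlt
      have : triangle P Q R ⊆ {z | 0 < chordSide x y z} := convexHull_min
        (fun X hX => (chordSide_pos_iff (hV X hX) h₁ h₂).2 ((hmax' X hX).trans_lt hlt))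
        (convex_chordSide_pos x y)
      exact (this hzT).ne' hz0
    by_contra! hne
    obtain ⟨w, hw, hw0⟩ := exists_mem_interior_chordSide_eq_zero hT hi (hsub hA) (hsub hB)
      ((chordSide_pos_iff (hV A hA) h₁ h₂).2 (lt_of_le_of_ne hle hne.1.symm))
      ((chordSide_neg_iff (hV B hB) h₁ h₂).2 (lt_of_le_of_ne hge hne.2))
    have hwb : ‖w‖ < 1 := by simpa using triangle_subset_ball hV (interior_subset hw)
    exact Set.disjoint_left.1 hdisj (mem_segment_of_chordSide_eq_zero h₁ h₂ hwb.le hw0) hw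
  · rintro (h | h)
    · refine ⟨turn_ne_turn h₁ h₂, hon A hA h, Set.disjoint_left.2 fun z hz hz' => ?_⟩
      have : triangle P Q R ⊆ {z | chordSide x y z ≤ 0} := convexHull_min
        (fun X hX => not_lt.1 fun hX' =>
          absurd ((chordSide_pos_iff (hV X hX) h₁ h₂).1 hX') (not_lt.2 (h ▸ hmin' X hX)))
        (convex_chordSide_nonpos x y)
      exact (chordSide_neg_of_mem_interior this hz').ne (chordSide_eq_zero_of_mem_segment hz)
    · refine ⟨turn_ne_turn h₁ h₂, hon B hB h, Set.disjoint_left.2 fun z hz hz' => ?_⟩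
      have : triangle P Q R ⊆ {z | 0 ≤ chordSide x y z} := convexHull_min
        (fun X hX => not_lt.1 fun hX' =>
          absurd ((chordSide_neg_iff (hV X hX) h₁ h₂).1 hX') (not_lt.2 (h ▸ hmax' X hX)))
        (convex_chordSide_nonneg x y)
      exact (chordSide_pos_of_mem_interior this hz').ne' (chordSide_eq_zero_of_mem_segment hz)

/-- The three chords from a point of the circle through the vertices do not all coincide. -/
theorem exists_chordLift_ne (hV : ∀ X ∈ ({P, Q, R} : Set ℂ), ‖X‖ < 1)
    (hi : (interior (triangle P Q R)).Nonempty) (h₁ : x < y) (h₂ : y < x + 1) :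
    ∃ X ∈ ({P, Q, R} : Set ℂ), chordLift X x ≠ y := by
  by_contra! h
  have h0 : ∀ X ∈ ({P, Q, R} : Set ℂ), chordSide x y X = 0 := fun X hX =>
    (chordSide_eq_zero_iff (hV X hX) h₁ h₂).2 (h X hX)
  obtain ⟨z, hz⟩ := hi
  refine lt_asymm
    (chordSide_neg_of_mem_interior (convexHull_min (fun X hX => (h0 X hX).le)
      (convex_chordSide_nonpos x y)) hz)
    (chordSide_pos_of_mem_interior (convexHull_min (fun X hX => (h0 X hX).ge)
      (convex_chordSide_nonneg x y)) hz)

theorem isCcwTangentPoint_turn (hV : ∀ X ∈ ({P, Q, R} : Set ℂ), ‖X‖ < 1)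
    (hi : (interior (triangle P Q R)).Nonempty)
    (hm : IsLeast ((fun X => chordLift X x) '' {P, Q, R}) m) :
    IsCcwTangentPoint P Q R (turn x) (turn m) := by
  obtain ⟨M, hM⟩ : ∃ M, IsGreatest ((fun X => chordLift X x) '' {P, Q, R}) M :=
    (Set.toFinite _).isCompact.exists_isGreatest ⟨m, hm.1⟩
  have hmem : ∀ t ∈ (fun X => chordLift X x) '' {P, Q, R}, x < t ∧ t < x + 1 := by
    rintro _ ⟨X, hX, rfl⟩
    exact ⟨lt_chordLift (hV X hX) x, chordLift_lt (hV X hX) x⟩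
  obtain ⟨hm1, hm2⟩ := hmem m hm.1
  obtain ⟨hM1, hM2⟩ := hmem M hM.1
  have hlt : m < M := by
    obtain ⟨X, hX, hne⟩ := exists_chordLift_ne hV hi hm1 hm2
    exact (lt_of_le_of_ne (hm.2 ⟨X, hX, rfl⟩) hne.symm).trans_le (hM.2 ⟨X, hX, rfl⟩)
  refine ⟨turn M, ?_, ?_⟩
  · ext u
    obtain ⟨y, hy1, hy2, rfl⟩ := exists_turn_eq x u
    simp only [Set.mem_ofPred_eq, Set.mem_insert_iff, Set.mem_singleton_iff]
    rcases hy1.eq_or_lt with rfl | hy1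
    · exact ⟨fun h => absurd rfl h.1, fun h => h.elim
        (fun h => absurd h.symm (turn_ne_turn hm1 hm2))
        (fun h => absurd h.symm (turn_ne_turn hM1 hM2))⟩
    · rw [isTangentChord_turn_iff hV hi hm hM hy1 hy2]
      have key : ∀ t, x < t → t < x + 1 → (y = t ↔ turn y = turn t) := by
        refine fun t ht1 ht2 => ⟨fun h => h ▸ rfl, fun h => ?_⟩
        by_contra hne
        rcases lt_or_gt_of_ne hne with h' | h'
        · exact turn_ne_turn h' (by linarith) h.symm
        · exact turn_ne_turn h' (by linarith) h
      rw [key m hm1 hm2, key M hM1 hM2]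
  · rw [ccwDist_turn hm1.le hm2, ccwDist_turn hM1.le hM2]
    linarith

theorem barBilliard_turn (hV : ∀ X ∈ ({P, Q, R} : Set ℂ), ‖X‖ < 1)
    (hi : (interior (triangle P Q R)).Nonempty)
    (hm : IsLeast ((fun X => chordLift X x) '' {P, Q, R}) m) :
    barBilliard P Q R (turn x) = turn m := by
  have h := isCcwTangentPoint_turn hV hi hm
  exact (Classical.epsilon_spec (p := IsCcwTangentPoint P Q R (turn x)) ⟨_, h⟩).unique h

end tangent

/-! ### The lift of the bar billiard map and its rotation number -/

section dynamics

variable {P Q R : ℂ}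

/-- The lift of the bar billiard map: among the three chords through the vertices, it selects the
one whose endpoint comes first in the counterclockwise direction. -/
def tangentLift (P Q R : ℂ) (x : ℝ) : ℝ := min (chordLift P x) (min (chordLift Q x) (chordLift R x))

theorem isLeast_tangentLift (P Q R : ℂ) (x : ℝ) :
    IsLeast ((fun X => chordLift X x) '' {P, Q, R}) (tangentLift P Q R x) := by
  simp only [Set.image_insert_eq, Set.image_singleton, tangentLift]
  refine ⟨?_, ?_⟩
  · rcases min_choice (chordLift P x) (min (chordLift Q x) (chordLift R x)) with h | h
    · rw [h]; simp
    · rw [h]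
      rcases min_choice (chordLift Q x) (chordLift R x) with h | h <;> rw [h] <;> simp
  · rintro _ (rfl | rfl | rfl) <;> simp

theorem tangentLift_le {X : ℂ} (hX : X ∈ ({P, Q, R} : Set ℂ)) (x : ℝ) :
    tangentLift P Q R x ≤ chordLift X x :=
  (isLeast_tangentLift P Q R x).2 ⟨X, hX, rfl⟩

theorem exists_tangentLift_eq (P Q R : ℂ) (x : ℝ) :
    ∃ X ∈ ({P, Q, R} : Set ℂ), tangentLift P Q R x = chordLift X x := by
  obtain ⟨X, hX, h⟩ := (isLeast_tangentLift P Q R x).1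
  exact ⟨X, hX, h.symm⟩

theorem continuous_tangentLift (hV : ∀ X ∈ ({P, Q, R} : Set ℂ), ‖X‖ < 1) :
    Continuous (tangentLift P Q R) :=
  (continuous_chordLift (hV P (by simp))).min
    ((continuous_chordLift (hV Q (by simp))).min (continuous_chordLift (hV R (by simp))))

theorem strictMono_tangentLift (hV : ∀ X ∈ ({P, Q, R} : Set ℂ), ‖X‖ < 1) :
    StrictMono (tangentLift P Q R) := by
  intro x y h
  obtain ⟨X, hX, e⟩ := exists_tangentLift_eq P Q R y
  rw [e]
  exact (tangentLift_le hX x).trans_lt (strictMono_chordLift (hV X hX) h)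

theorem tangentLift_add_one (P Q R : ℂ) (x : ℝ) :
    tangentLift P Q R (x + 1) = tangentLift P Q R x + 1 := by
  simp only [tangentLift, chordLift_add_one, min_add_add_right]

theorem lt_tangentLift (hV : ∀ X ∈ ({P, Q, R} : Set ℂ), ‖X‖ < 1) (x : ℝ) :
    x < tangentLift P Q R x := by
  obtain ⟨X, hX, e⟩ := exists_tangentLift_eq P Q R x
  rw [e]
  exact lt_chordLift (hV X hX) x

theorem tangentLift_lt (hV : ∀ X ∈ ({P, Q, R} : Set ℂ), ‖X‖ < 1) (x : ℝ) :
    tangentLift P Q R x < x + 1 := by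
  obtain ⟨X, hX, e⟩ := exists_tangentLift_eq P Q R x
  rw [e]
  exact chordLift_lt (hV X hX) x

/-- `tangentLift` as a bundled lift of a circle map of degree one. -/
def tangentDeg1Lift (hV : ∀ X ∈ ({P, Q, R} : Set ℂ), ‖X‖ < 1) : CircleDeg1Lift where
  toFun := tangentLift P Q R
  monotone' := (strictMono_tangentLift hV).monotone
  map_add_one' := tangentLift_add_one P Q R

theorem coe_tangentDeg1Lift (hV : ∀ X ∈ ({P, Q, R} : Set ℂ), ‖X‖ < 1) :
    ⇑(tangentDeg1Lift hV) = tangentLift P Q R := rfl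

theorem barBilliard_turn_eq (hV : ∀ X ∈ ({P, Q, R} : Set ℂ), ‖X‖ < 1)
    (hi : (interior (triangle P Q R)).Nonempty) (x : ℝ) :
    barBilliard P Q R (turn x) = turn (tangentLift P Q R x) :=
  barBilliard_turn hV hi (isLeast_tangentLift P Q R x)

theorem isNormalizedLift_tangentDeg1Lift (hV : ∀ X ∈ ({P, Q, R} : Set ℂ), ‖X‖ < 1)
    (hi : (interior (triangle P Q R)).Nonempty) :
    IsNormalizedLift (tangentDeg1Lift hV) (barBilliard P Q R) where
  continuous := continuous_tangentLift hV
  lifts := barBilliard_turn_eq hV hi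
  zero_mem := ⟨lt_tangentLift hV 0, by simpa [coe_tangentDeg1Lift] using tangentLift_lt hV 0⟩

theorem continuous_barBilliard (hV : ∀ X ∈ ({P, Q, R} : Set ℂ), ‖X‖ < 1)
    (hi : (interior (triangle P Q R)).Nonempty) : Continuous (barBilliard P Q R) := by
  -- Near any point, the argument in turns of a point of the circle has a continuous branch.
  rw [continuous_iff_continuousAt]
  intro v
  obtain ⟨a, rfl⟩ := turn_surjective v
  have h : barBilliard P Q R = fun u : Circle =>
      turn (tangentLift P Q R (a + Complex.arg ((u / turn a : Circle) : ℂ) / (2 * Real.pi))) := by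
    funext u
    rw [← barBilliard_turn_eq hV hi, turn_add]
    congr 1
    rw [turn.eq_1 (_ / _), mul_div_cancel₀ _ (by positivity : (2 * Real.pi) ≠ 0), Circle.exp_arg,
      mul_div_cancel]
  rw [h]
  refine continuous_turn.continuousAt.comp ((continuous_tangentLift hV).continuousAt.comp ?_)
  refine continuousAt_const.add (ContinuousAt.div_const ?_ _)
  have h1 : ContinuousAt Complex.arg ((turn a / turn a : Circle) : ℂ) := by
    apply Complex.continuousAt_arg
    simp
  exact ContinuousAt.comp (f := fun u : Circle => ((u / turn a : Circle) : ℂ)) h1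
    (by fun_prop)

theorem isHomeomorph_barBilliard (hV : ∀ X ∈ ({P, Q, R} : Set ℂ), ‖X‖ < 1)
    (hi : (interior (triangle P Q R)).Nonempty) : IsHomeomorph (barBilliard P Q R) := by
  rw [isHomeomorph_iff_continuous_bijective]
  refine ⟨continuous_barBilliard hV hi, fun u v h => ?_, fun v => ?_⟩
  · obtain ⟨x, rfl⟩ := turn_surjective u
    obtain ⟨y, rfl⟩ := turn_surjective v
    rw [barBilliard_turn_eq hV hi, barBilliard_turn_eq hV hi, turn_eq_turn_iff] at h
    obtain ⟨m, hm⟩ := h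
    have h2 := (tangentDeg1Lift hV).map_add_int y m
    rw [coe_tangentDeg1Lift, ← hm] at h2
    exact turn_eq_turn_iff.2 ⟨m, ((strictMono_tangentLift hV).injective h2).symm⟩
  · obtain ⟨y, rfl⟩ := turn_surjective v
    obtain ⟨x, hx⟩ := mem_range_of_exists_le_of_exists_ge (continuous_tangentLift hV)
      ⟨y - 1, by linarith [tangentLift_lt hV (y - 1)]⟩ ⟨y, (lt_tangentLift hV y).le⟩
    exact ⟨turn x, by rw [barBilliard_turn_eq hV hi, hx]⟩

theorem tangentDeg1Lift_pow_three (hV : ∀ X ∈ ({P, Q, R} : Set ℂ), ‖X‖ < 1) (x : ℝ) :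
    (tangentDeg1Lift hV ^ 3) x = tangentLift P Q R (tangentLift P Q R (tangentLift P Q R x)) := by
  rw [CircleDeg1Lift.coe_pow]; rfl

theorem tangentLift_tangentLift_lt (hV : ∀ X ∈ ({P, Q, R} : Set ℂ), ‖X‖ < 1)
    (hi : (interior (triangle P Q R)).Nonempty) (x : ℝ) :
    tangentLift P Q R (tangentLift P Q R x) < x + 1 := by
  -- If `Y` is not on the tangent chord from `turn x`, the chord through `Y` from the second
  -- endpoint of that tangent ends before `turn x`.
  obtain ⟨Y, hY, hne⟩ := exists_chordLift_ne hV hi (lt_tangentLift hV x) (tangentLift_lt hV x)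
  have h := strictMono_chordLift (hV Y hY) (lt_of_le_of_ne (tangentLift_le hY x) hne.symm)
  rw [chordLift_chordLift (hV Y hY)] at h
  exact (tangentLift_le hY _).trans_lt h

theorem translationNumber_tangentDeg1Lift_lt (hV : ∀ X ∈ ({P, Q, R} : Set ℂ), ‖X‖ < 1)
    (hi : (interior (triangle P Q R)).Nonempty) :
    (tangentDeg1Lift hV).translationNumber < 1 / 2 := by
  have h2 : ∀ x, (tangentDeg1Lift hV ^ 2) x < x + 1 := fun x => by
    rw [CircleDeg1Lift.coe_pow]
    exact tangentLift_tangentLift_lt hV hi x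
  have h3 := CircleDeg1Lift.translationNumber_lt_of_forall_lt_add _
    ((tangentDeg1Lift hV).continuous_pow (continuous_tangentLift hV) 2) h2
  rw [CircleDeg1Lift.translationNumber_pow] at h3
  push_cast at h3
  linarith

/-- Three consecutive chords through points of the disk, two of which coincide, run around the
circle more than once. -/
theorem add_one_lt_chordLift_three {X Y Z : ℂ} (hX : ‖X‖ < 1) (hY : ‖Y‖ < 1) (hZ : ‖Z‖ < 1)
    (h : X = Y ∨ Y = Z ∨ X = Z) (x : ℝ) :
    x + 1 < chordLift Z (chordLift Y (chordLift X x)) := by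
  rcases h with rfl | rfl | rfl
  · rw [chordLift_chordLift hX]
    exact lt_chordLift hZ _
  · rw [chordLift_chordLift hY]
    linarith [lt_chordLift hX x]
  · rw [← chordLift_chordLift hX]
    exact strictMono_chordLift hX (lt_chordLift hY _)

/-- A line through two points of the disk meets the circle. -/
theorem exists_chordLift_eq (hP : ‖P‖ < 1) (hQ : ‖Q‖ < 1) :
    ∃ x, chordLift P x = chordLift Q x := by
  have hc : Continuous fun x => chordLift P x - chordLift Q x :=
    (continuous_chordLift hP).sub (continuous_chordLift hQ)
  -- The order of the two second endpoints is reversed between `x` and `chordLift Q x`.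
  have key : ∃ a b, chordLift P a - chordLift Q a ≤ 0 ∧ 0 ≤ chordLift P b - chordLift Q b := by
    rcases le_total (chordLift P 0) (chordLift Q 0) with h | h
    · have h2 := (strictMono_chordLift hP).monotone h
      rw [chordLift_chordLift hP] at h2
      exact ⟨0, chordLift Q 0, by linarith, by linarith [chordLift_chordLift hQ 0]⟩
    · have h2 := (strictMono_chordLift hQ).monotone h
      rw [chordLift_chordLift hQ] at h2
      exact ⟨chordLift P 0, 0, by linarith [chordLift_chordLift hP 0], by linarith⟩
  obtain ⟨a, b, ha, hb⟩ := key
  obtain ⟨x, hx⟩ := mem_range_of_exists_le_of_exists_ge hc ⟨a, ha⟩ ⟨b, hb⟩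
  exact ⟨x, sub_eq_zero.1 hx⟩

/-- One of the two orientations of the line `PQ` is a tangent chord of the bar billiard. -/
theorem exists_tangentLift_eq_eq (hV : ∀ X ∈ ({P, Q, R} : Set ℂ), ‖X‖ < 1) :
    ∃ x, tangentLift P Q R x = chordLift P x ∧ tangentLift P Q R x = chordLift Q x := by
  have hP := hV P (by simp)
  have hQ := hV Q (by simp)
  have hR := hV R (by simp)
  have key : ∃ x, chordLift P x = chordLift Q x ∧ chordLift Q x ≤ chordLift R x := by
    obtain ⟨x, hx⟩ := exists_chordLift_eq hP hQ
    rcases le_or_gt (chordLift Q x) (chordLift R x) with h | h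
    · exact ⟨x, hx, h⟩
    · have h2 := strictMono_chordLift hR h
      rw [chordLift_chordLift hR] at h2
      refine ⟨chordLift Q x, ?_, ?_⟩
      · rw [chordLift_chordLift hQ, ← hx, chordLift_chordLift hP]
      · rw [chordLift_chordLift hQ]; exact h2.le
  obtain ⟨x, h1, h2⟩ := key
  have h3 : tangentLift P Q R x = chordLift P x := by
    rw [tangentLift, min_eq_left h2, min_eq_left h1.le]
  exact ⟨x, h3, h3.trans h1⟩

/-- The orbit starting along the side `PQ` winds around the circle more than once in three steps: the
first chord may be attributed to either of `P` and `Q`, so that some vertex is used twice. -/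
theorem exists_add_one_lt_tangentLift_three (hV : ∀ X ∈ ({P, Q, R} : Set ℂ), ‖X‖ < 1) :
    ∃ x, x + 1 < tangentLift P Q R (tangentLift P Q R (tangentLift P Q R x)) := by
  obtain ⟨x, hxP, hxQ⟩ := exists_tangentLift_eq_eq hV
  obtain ⟨Y, hY, eY⟩ := exists_tangentLift_eq P Q R (tangentLift P Q R x)
  obtain ⟨Z, hZ, eZ⟩ := exists_tangentLift_eq P Q R (tangentLift P Q R (tangentLift P Q R x))
  have hX : ∃ X ∈ ({P, Q, R} : Set ℂ), tangentLift P Q R x = chordLift X x ∧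
      (X = Y ∨ Y = Z ∨ X = Z) := by
    have hP' : P ∈ ({P, Q, R} : Set ℂ) := by simp
    have hQ' : Q ∈ ({P, Q, R} : Set ℂ) := by simp
    rcases hY with rfl | rfl | rfl
    · exact ⟨_, hP', hxP, Or.inl rfl⟩
    · exact ⟨_, hQ', hxQ, Or.inl rfl⟩
    · rcases hZ with rfl | rfl | rfl
      · exact ⟨_, hP', hxP, Or.inr (Or.inr rfl)⟩
      · exact ⟨_, hQ', hxQ, Or.inr (Or.inr rfl)⟩
      · exact ⟨_, hP', hxP, Or.inr (Or.inl rfl)⟩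
  obtain ⟨X, hX, eX, h⟩ := hX
  refine ⟨x, ?_⟩
  rw [eZ, eY, eX]
  exact add_one_lt_chordLift_three (hV X hX) (hV Y hY) (hV Z hZ) h x

theorem one_third_le_translationNumber (hV : ∀ X ∈ ({P, Q, R} : Set ℂ), ‖X‖ < 1) :
    1 / 3 ≤ (tangentDeg1Lift hV).translationNumber := by
  obtain ⟨x, hx⟩ := exists_add_one_lt_tangentLift_three hV
  rw [← tangentDeg1Lift_pow_three hV] at hx
  have h := CircleDeg1Lift.le_translationNumber_of_add_nat_le (m := 1) _
    (by simpa using hx.le : x + (1 : ℕ) ≤ _)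
  rw [CircleDeg1Lift.translationNumber_pow] at h
  push_cast at h
  linarith

/-- If no composition of the three half-turns about the vertices fixes a point of the circle,
then the rotation number exceeds `1 / 3`. -/
theorem one_third_lt_translationNumber (hV : ∀ X ∈ ({P, Q, R} : Set ℂ), ‖X‖ < 1)
    (h : ∀ X ∈ ({P, Q, R} : Set ℂ), ∀ Y ∈ ({P, Q, R} : Set ℂ), ∀ Z ∈ ({P, Q, R} : Set ℂ),
      X ≠ Y → Y ≠ Z → X ≠ Z → ∀ x,
      turn (chordLift Z (chordLift Y (chordLift X x))) ≠ turn x) :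
    1 / 3 < (tangentDeg1Lift hV).translationNumber := by
  have hc := (tangentDeg1Lift hV).continuous_pow (continuous_tangentLift hV) 3
  have hne : ∀ x, (tangentDeg1Lift hV ^ 3) x ≠ x + 1 := by
    intro x hx
    rw [tangentDeg1Lift_pow_three] at hx
    obtain ⟨X, hX, eX⟩ := exists_tangentLift_eq P Q R x
    obtain ⟨Y, hY, eY⟩ := exists_tangentLift_eq P Q R (tangentLift P Q R x)
    obtain ⟨Z, hZ, eZ⟩ := exists_tangentLift_eq P Q R (tangentLift P Q R (tangentLift P Q R x))
    rw [eZ, eY, eX] at hx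
    have hd : ¬(X = Y ∨ Y = Z ∨ X = Z) := fun hd =>
      (add_one_lt_chordLift_three (hV X hX) (hV Y hY) (hV Z hZ) hd x).ne' hx
    push Not at hd
    refine h X hX Y hY Z hZ hd.1 hd.2.1 hd.2.2 x ?_
    rw [hx, turn_add_one]
  obtain ⟨a, ha⟩ := exists_add_one_lt_tangentLift_three hV
  rw [← tangentDeg1Lift_pow_three hV] at ha
  have hlt : ∀ x, x + 1 < (tangentDeg1Lift hV ^ 3) x := by
    intro x
    by_contra! hle
    obtain ⟨y, hy⟩ := mem_range_of_exists_le_of_exists_ge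
      (f := fun x => (tangentDeg1Lift hV ^ 3) x - x) (c := 1) (hc.sub continuous_id)
      ⟨x, by linarith⟩ ⟨a, by linarith⟩
    exact hne y (by linarith [hy])
  have h3 := CircleDeg1Lift.lt_translationNumber_of_forall_add_lt _ hc hlt
  rw [CircleDeg1Lift.translationNumber_pow] at h3
  push_cast at h3
  linarith

/-- If the composition of the half-turns about the vertices fixes a point of the circle, then the
rotation number is at most `1 / 3`. -/
theorem translationNumber_le_one_third (hV : ∀ X ∈ ({P, Q, R} : Set ℂ), ‖X‖ < 1) {x : ℝ}
    (h : turn (chordLift P (chordLift Q (chordLift R x))) = turn x) :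
    (tangentDeg1Lift hV).translationNumber ≤ 1 / 3 := by
  have hP := hV P (by simp)
  have hQ := hV Q (by simp)
  have hR := hV R (by simp)
  have hle : ∀ X ∈ ({P, Q, R} : Set ℂ), ∀ Y ∈ ({P, Q, R} : Set ℂ), ∀ Z ∈ ({P, Q, R} : Set ℂ),
      ∀ y, tangentLift P Q R (tangentLift P Q R (tangentLift P Q R y))
        ≤ chordLift X (chordLift Y (chordLift Z y)) := fun X hX Y hY Z hZ y =>
    (tangentLift_le hX _).trans <| (strictMono_chordLift (hV X hX)).monotone <|
      (tangentLift_le hY _).trans <| (strictMono_chordLift (hV Y hY)).monotone <|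
        tangentLift_le hZ _
  have key : ∃ y, (tangentDeg1Lift hV ^ 3) y ≤ y + 1 := by
    simp only [tangentDeg1Lift_pow_three]
    obtain ⟨m, hm⟩ := turn_eq_turn_iff.1 h
    have a1 := lt_chordLift hR x
    have b1 := chordLift_lt hR x
    have a2 := lt_chordLift hQ (chordLift R x)
    have b2 := chordLift_lt hQ (chordLift R x)
    have a3 := lt_chordLift hP (chordLift Q (chordLift R x))
    have b3 := chordLift_lt hP (chordLift Q (chordLift R x))
    have m0 : (0 : ℝ) < m := by linarith
    have m3 : (m : ℝ) < 3 := by linarith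
    have m0' : 0 < m := by exact_mod_cast m0
    have m3' : m < 3 := by exact_mod_cast m3
    obtain rfl | rfl : m = 1 ∨ m = 2 := by omega
    · exact ⟨x, (hle P (by simp) Q (by simp) R (by simp) x).trans (by rw [hm]; simp)⟩
    · -- The composition in the opposite order is the inverse up to a translation by `3`, and
      -- so winds once around the circle.
      have hinv : chordLift R (chordLift Q (chordLift P (x + 2))) = x + 3 := by
        have e : x + 2 = chordLift P (chordLift Q (chordLift R x)) := by rw [hm]; simp
        rw [e, chordLift_chordLift hP, chordLift_add_one, chordLift_chordLift hQ,
          chordLift_add_one, chordLift_add_one, chordLift_chordLift hR]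
        ring
      exact ⟨x + 2, (hle R (by simp) Q (by simp) P (by simp) _).trans (by rw [hinv]; linarith)⟩
  obtain ⟨y, hy⟩ := key
  have h3 := CircleDeg1Lift.translationNumber_le_of_le_add_nat (m := 1) _
    (by simpa using hy : _ ≤ y + (1 : ℕ))
  rw [CircleDeg1Lift.translationNumber_pow] at h3
  push_cast at h3
  linarith

end dynamics

/-! ### Fixed points of products of three half-turns -/

section halfTurn

/-- The Lorentz product `1 - ⟨P, Q⟩` of the vectors `(P, 1)` and `(Q, 1)`, which represent the
points `P` and `Q` in the projective model of the hyperbolic plane. -/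
def lorentz (P Q : ℂ) : ℝ := 1 - (P.re * Q.re + P.im * Q.im)

/-- The determinant of the vectors `(P, 1)`, `(Q, 1)`, `(R, 1)`. -/
def det₃ (P Q R : ℂ) : ℝ :=
  (Q.re - P.re) * (R.im - P.im) - (Q.im - P.im) * (R.re - P.re)

variable {P Q R : ℂ}

theorem lorentz_self (P : ℂ) : lorentz P P = 1 - ‖P‖ ^ 2 := by
  rw [lorentz, Complex.sq_norm, Complex.normSq_apply]

theorem lorentz_self_pos (hP : ‖P‖ < 1) : 0 < lorentz P P := by
  rw [lorentz_self]; nlinarith [norm_nonneg P]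

theorem lorentz_self_pos_iff : 0 < lorentz P P ↔ ‖P‖ < 1 := by
  refine ⟨fun h => ?_, lorentz_self_pos⟩
  rw [lorentz_self] at h
  nlinarith [norm_nonneg P]

/-- The diagonal entry of the product of the matrices in `SU(1, 1)`, up to scaling, of the
half-turns about `P`, `Q`, `R`. -/
def halfTurnDiag (P Q R : ℂ) : ℂ := I * (-1 + P * conj Q) + I * conj R * (Q - P)

/-- The off-diagonal entry of the product of the matrices of three half-turns. -/
def halfTurnOff (P Q R : ℂ) : ℂ := I * (R - P * conj Q * R - Q + P)

theorem normSq_halfTurnDiag_sub (P Q R : ℂ) :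
    normSq (halfTurnDiag P Q R) - normSq (halfTurnOff P Q R)
      = lorentz P P * lorentz Q Q * lorentz R R := by
  simp only [halfTurnDiag, halfTurnOff, lorentz, normSq_apply, mul_re, mul_im, add_re, add_im,
    sub_re, sub_im, I_re, I_im, neg_re, neg_im, one_re, one_im, conj_re, conj_im]
  ring

/-- The trace of a product of three half-turns is, up to scaling, the determinant of their
centres. -/
theorem halfTurnDiag_re_sq (P Q R : ℂ) : (halfTurnDiag P Q R).re ^ 2 = det₃ P Q R ^ 2 := by
  simp only [halfTurnDiag, det₃, mul_re, mul_im, add_re, add_im,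
    sub_re, sub_im, I_re, I_im, neg_re, neg_im, one_re, one_im, conj_re, conj_im]
  ring

theorem one_sub_conj_mul_ne_zero (hP : ‖P‖ < 1) (x : ℝ) : 1 - conj P * turn x ≠ 0 := by
  intro h
  apply one_sub_ne_zero hP x
  rw [← map_eq_zero (starRingEnd ℂ)]
  simpa using h

/-- The composition of three half-turns fixes `turn x` precisely if a real trigonometric
equation holds. -/
theorem turn_chordLift_three_eq_iff (hP : ‖P‖ < 1) (hQ : ‖Q‖ < 1) (hR : ‖R‖ < 1) (x : ℝ) :
    turn (chordLift P (chordLift Q (chordLift R x))) = turn x ↔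
      (conj (halfTurnOff P Q R) * turn x).im = (halfTurnDiag P Q R).im := by
  have e1 := turn_chordLift_mul (P := R) x
  have e2 := turn_chordLift_mul (P := Q) (chordLift R x)
  have e3 := turn_chordLift_mul (P := P) (chordLift Q (chordLift R x))
  have n1 := one_sub_conj_mul_ne_zero hR x
  have n2 := one_sub_conj_mul_ne_zero hQ (chordLift R x)
  have n3 := one_sub_conj_mul_ne_zero hP (chordLift Q (chordLift R x))
  have hv := turn_mul_conj x
  have hv0 : (turn x : ℂ) ≠ 0 := Circle.coe_ne_zero _
  rw [← Circle.coe_inj]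
  generalize (turn x : ℂ) = v at *
  generalize (turn (chordLift R x) : ℂ) = v₁ at *
  generalize (turn (chordLift Q (chordLift R x)) : ℂ) = v₂ at *
  generalize (turn (chordLift P (chordLift Q (chordLift R x))) : ℂ) = v₃ at *
  have him : ∀ z : ℂ, 2 * I * (z.im : ℂ) = z - conj z := fun z => by
    rw [Complex.sub_conj]; push_cast; ring
  have key : (v₃ - v) * ((1 - conj P * v₂) * (1 - conj Q * v₁) * (1 - conj R * v))
      = 2 * v * (((halfTurnDiag P Q R).im - (conj (halfTurnOff P Q R) * v).im : ℝ) : ℂ) := by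
    have h1 : 2 * v * (((halfTurnDiag P Q R).im - (conj (halfTurnOff P Q R) * v).im : ℝ) : ℂ)
        = -I * v * ((halfTurnDiag P Q R - conj (halfTurnDiag P Q R))
          - (conj (halfTurnOff P Q R) * v - conj (conj (halfTurnOff P Q R) * v))) := by
      rw [← him, ← him]
      push_cast
      linear_combination (2 * v * (((halfTurnDiag P Q R).im : ℂ)
        - (conj (halfTurnOff P Q R) * v).im)) * I_sq
    have h2 : (v₃ - v) * ((1 - conj P * v₂) * (1 - conj Q * v₁) * (1 - conj R * v))
        = (P * ((1 - conj R * v) - conj Q * (R - v)) - (Q * (1 - conj R * v) - (R - v)))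
          - v * (((1 - conj R * v) - conj Q * (R - v))
            - conj P * (Q * (1 - conj R * v) - (R - v))) := by
      have e12 : v₂ * (1 - conj Q * v₁) * (1 - conj R * v) = Q * (1 - conj R * v) - (R - v) := by
        linear_combination (1 - conj R * v) * e2 - e1
      linear_combination ((1 - conj Q * v₁) * (1 - conj R * v)) * e3
        - (1 - v * conj P) * e12 - (P - v) * conj Q * e1
    rw [h1, h2]
    simp only [halfTurnDiag, halfTurnOff, map_add, map_sub, map_mul, map_neg, map_one, conj_I,
      conj_conj]
    linear_combination (v * ((-1 + P * conj Q) + conj R * (Q - P) + (-1 + conj P * Q)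
      + R * (conj Q - conj P)) + (conj R - conj P * Q * conj R - conj Q + conj P) * v ^ 2
      + (R - P * conj Q * R - Q + P) * (v * conj v)) * I_sq
      - (R - P * conj Q * R - Q + P) * hv
  constructor
  · intro h
    rw [h, sub_self, zero_mul, eq_comm, mul_eq_zero, ofReal_eq_zero, sub_eq_zero] at key
    rcases key with h' | h'
    · simp [hv0] at h'
    · exact h'.symm
  · intro h
    rw [h, sub_self, ofReal_zero, mul_zero, mul_eq_zero, sub_eq_zero] at key
    refine key.resolve_right ?_
    exact mul_ne_zero (mul_ne_zero n3 n2) n1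

/-- If the composition of three half-turns has a fixed point on the circle, then its trace is at
least `2` in absolute value. -/
theorem le_det₃_sq_of_fixed (hP : ‖P‖ < 1) (hQ : ‖Q‖ < 1) (hR : ‖R‖ < 1) {x : ℝ}
    (h : turn (chordLift P (chordLift Q (chordLift R x))) = turn x) :
    lorentz P P * lorentz Q Q * lorentz R R ≤ det₃ P Q R ^ 2 := by
  rw [turn_chordLift_three_eq_iff hP hQ hR] at h
  have h1 : |(halfTurnDiag P Q R).im| ≤ ‖halfTurnOff P Q R‖ := by
    rw [← h]
    refine (Complex.abs_im_le_norm _).trans ?_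
    rw [norm_mul, RCLike.norm_conj, Circle.norm_coe, mul_one]
  have h2 := normSq_halfTurnDiag_sub P Q R
  rw [← Complex.sq_norm (halfTurnOff P Q R), normSq_apply] at h2
  have h3 := sq_le_sq' (abs_le.1 h1).1 (abs_le.1 h1).2
  nlinarith [halfTurnDiag_re_sq P Q R]

theorem exists_fixed_of_le_det₃_sq (hP : ‖P‖ < 1) (hQ : ‖Q‖ < 1) (hR : ‖R‖ < 1)
    (h : lorentz P P * lorentz Q Q * lorentz R R ≤ det₃ P Q R ^ 2) :
    ∃ x, turn (chordLift P (chordLift Q (chordLift R x))) = turn x := by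
  simp only [turn_chordLift_three_eq_iff hP hQ hR]
  set β := halfTurnOff P Q R
  set a := (halfTurnDiag P Q R).im with ha
  have h1 : a ^ 2 ≤ ‖β‖ ^ 2 := by
    have h2 := normSq_halfTurnDiag_sub P Q R
    rw [← Complex.sq_norm (halfTurnOff P Q R), normSq_apply] at h2
    nlinarith [halfTurnDiag_re_sq P Q R]
  obtain ⟨hb1, hb2⟩ := abs_le.1 (abs_le_of_sq_le_sq h1 (norm_nonneg _))
  refine ⟨(arg β + Real.arcsin (a / ‖β‖)) / (2 * Real.pi), ?_⟩
  rw [coe_turn, mul_div_cancel₀ _ (by positivity : (2 * Real.pi) ≠ 0)]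
  have h4 : conj β = ‖β‖ * Complex.exp (-(arg β * I)) := by
    conv_lhs => rw [← Complex.norm_mul_exp_arg_mul_I β]
    rw [map_mul, ← Complex.exp_conj]
    simp only [map_mul, conj_ofReal, conj_I]
    ring_nf
  rw [h4, mul_assoc, ← Complex.exp_add,
    show -((arg β : ℂ) * I) + ((arg β + Real.arcsin (a / ‖β‖) : ℝ) : ℂ) * I
      = ((Real.arcsin (a / ‖β‖) : ℝ) : ℂ) * I by push_cast; ring, Complex.im_ofReal_mul,
    Complex.exp_ofReal_mul_I_im]
  rcases (norm_nonneg β).eq_or_lt with h0 | h0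
  · rw [← h0] at hb1 hb2 ⊢
    linarith
  · rw [Real.sin_arcsin]
    · field_simp
    · rw [le_div_iff₀ h0]; linarith
    · rw [div_le_iff₀ h0]; linarith

end halfTurn

/-! ### Hyperbolic distances -/

section distance

variable {P Q R S : ℂ}

/-- The negative Gram determinant of two points in the projective model. -/
def gram (P Q : ℂ) : ℝ := lorentz P Q ^ 2 - lorentz P P * lorentz Q Q

theorem gram_eq (P Q : ℂ) : gram P Q =
    (Q.re - P.re) ^ 2 + (Q.im - P.im) ^ 2
      - (P.re * (Q.im - P.im) - P.im * (Q.re - P.re)) ^ 2 := by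
  unfold gram lorentz; ring

theorem gram_nonneg (hP : ‖P‖ < 1) : 0 ≤ gram P Q := by
  have h := lorentz_self_pos hP
  rw [lorentz] at h
  rw [gram_eq]
  nlinarith [sq_nonneg (P.re * (Q.re - P.re) + P.im * (Q.im - P.im)),
    mul_nonneg h.le (add_nonneg (sq_nonneg (Q.re - P.re)) (sq_nonneg (Q.im - P.im)))]

theorem gram_pos (hP : ‖P‖ < 1) (hPQ : P ≠ Q) : 0 < gram P Q := by
  have h := lorentz_self_pos hP
  have h2 : 0 < (Q.re - P.re) ^ 2 + (Q.im - P.im) ^ 2 := by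
    have h3 := Complex.normSq_pos.2 (sub_ne_zero.2 hPQ.symm)
    rw [Complex.normSq_apply, Complex.sub_re, Complex.sub_im] at h3
    nlinarith
  rw [lorentz] at h
  rw [gram_eq]
  nlinarith [sq_nonneg (P.re * (Q.re - P.re) + P.im * (Q.im - P.im)), mul_pos h h2]

theorem lorentz_pos (hP : ‖P‖ < 1) (hQ : ‖Q‖ < 1) : 0 < lorentz P Q := by
  have a := lorentz_self_pos hP
  have b := lorentz_self_pos hQ
  unfold lorentz at *
  nlinarith [sq_nonneg (P.re - Q.re), sq_nonneg (P.im - Q.im)]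

theorem kleinDist_eq (hP : ‖P‖ < 1) (hQ : ‖Q‖ < 1) :
    kleinDist P Q = Real.arcosh (lorentz P Q / √(lorentz P P * lorentz Q Q)) := by
  have a := lorentz_self_pos hP
  have b := lorentz_self_pos hQ
  rw [kleinDist, poincareDist, Real.sqrt_mul a.le]
  congr 1
  unfold kleinToPoincare
  rw [← lorentz_self, ← lorentz_self]
  have hs := Real.sq_sqrt a.le
  have ht := Real.sq_sqrt b.le
  have hs0 := Real.sqrt_pos.2 a
  have ht0 := Real.sqrt_pos.2 b
  set s := √(lorentz P P) with hsdef
  set t := √(lorentz Q Q) with htdef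
  rw [← Complex.normSq_eq_norm_sq, ← Complex.normSq_eq_norm_sq, ← Complex.normSq_eq_norm_sq]
  simp only [Complex.normSq_apply, Complex.sub_re, Complex.sub_im, Complex.re_ofReal_mul,
    Complex.im_ofReal_mul]
  have h1 : 1 - (1 / (1 + s) * P.re * (1 / (1 + s) * P.re)
      + 1 / (1 + s) * P.im * (1 / (1 + s) * P.im)) = 2 * s / (1 + s) := by
    field_simp
    unfold lorentz at hs
    linear_combination -hs
  have h2 : 1 - (1 / (1 + t) * Q.re * (1 / (1 + t) * Q.re)
      + 1 / (1 + t) * Q.im * (1 / (1 + t) * Q.im)) = 2 * t / (1 + t) := by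
    field_simp
    unfold lorentz at ht
    linear_combination -ht
  rw [h1, h2]
  field_simp
  unfold lorentz at hs ht ⊢
  linear_combination (1 + t) ^ 2 * hs + (1 + s) ^ 2 * ht

theorem one_le_lorentz_div (hP : ‖P‖ < 1) (hQ : ‖Q‖ < 1) :
    1 ≤ lorentz P Q / √(lorentz P P * lorentz Q Q) := by
  have a := mul_pos (lorentz_self_pos hP) (lorentz_self_pos hQ)
  rw [one_le_div (Real.sqrt_pos.2 a), Real.sqrt_le_left (lorentz_pos hP hQ).le]
  have := gram_nonneg (Q := Q) hP
  unfold gram at this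
  linarith

theorem kleinDist_nonneg (hP : ‖P‖ < 1) (hQ : ‖Q‖ < 1) : 0 ≤ kleinDist P Q := by
  rw [kleinDist_eq hP hQ]
  exact Real.arcosh_nonneg (one_le_lorentz_div hP hQ)

theorem sinh_kleinDist_sq (hP : ‖P‖ < 1) (hQ : ‖Q‖ < 1) :
    Real.sinh (kleinDist P Q) ^ 2 = gram P Q / (lorentz P P * lorentz Q Q) := by
  have a := mul_pos (lorentz_self_pos hP) (lorentz_self_pos hQ)
  rw [Real.sinh_sq, kleinDist_eq hP hQ, Real.cosh_arcosh (one_le_lorentz_div hP hQ), div_pow,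
    Real.sq_sqrt a.le, gram, sub_div, div_self a.ne']

theorem kleinDist_pos (hP : ‖P‖ < 1) (hQ : ‖Q‖ < 1) (hPQ : P ≠ Q) : 0 < kleinDist P Q := by
  refine (kleinDist_nonneg hP hQ).lt_of_ne' fun h => ?_
  have h2 := sinh_kleinDist_sq hP hQ
  rw [h, Real.sinh_zero, zero_pow two_ne_zero] at h2
  have := div_pos (gram_pos hP hPQ) (mul_pos (lorentz_self_pos hP) (lorentz_self_pos hQ))
  linarith

theorem sinh_log_exp_add_div {d : ℝ} (hd : 0 < d) :
    Real.sinh (Real.log ((Real.exp d + 1) / (Real.exp d - 1))) = 1 / Real.sinh d := by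
  have h1 : 1 < Real.exp d := Real.one_lt_exp_iff.2 hd
  have h2 : 0 < Real.exp d - 1 := by linarith
  rw [Real.sinh_log (by positivity), Real.sinh_eq, Real.exp_neg]
  have h3 : Real.exp d ^ 2 - 1 ≠ 0 := by nlinarith
  have h4 : Real.exp d - (Real.exp d)⁻¹ ≠ 0 := by
    intro h
    apply h3
    field_simp at h
    linarith
  field_simp
  ring

theorem kleinDist_lt_DeltaKlein_iff (hP : ‖P‖ < 1) (hQ : ‖Q‖ < 1) (hPQ : P ≠ Q) (hR : ‖R‖ < 1)
    (hS : ‖S‖ < 1) : kleinDist R S < DeltaKlein P Q ↔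
      gram R S * gram P Q < lorentz R R * lorentz S S * (lorentz P P * lorentz Q Q) := by
  have hd := kleinDist_pos hP hQ hPQ
  have hs := Real.sinh_pos_iff.2 hd
  have hs' := Real.sinh_nonneg_iff.2 (kleinDist_nonneg hR hS)
  have a := mul_pos (lorentz_self_pos hP) (lorentz_self_pos hQ)
  have b := mul_pos (lorentz_self_pos hR) (lorentz_self_pos hS)
  rw [← Real.sinh_lt_sinh, DeltaKlein, sinh_log_exp_add_div hd, lt_div_iff₀ hs,
    ← sq_lt_one_iff₀ (by positivity), mul_pow, sinh_kleinDist_sq hP hQ, sinh_kleinDist_sq hR hS,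
    div_mul_div_comm, div_lt_one (by positivity)]

/-- The Gram determinant of `R` and a point `S` of the line `PQ` decomposes into the contribution
of the distance to the line and a square, which vanishes at the foot of the perpendicular. -/
theorem gram_mul_gram_lineMap (P Q R : ℂ) (t : ℝ) :
    gram R (AffineMap.lineMap P Q t) * gram P Q =
      det₃ P Q R ^ 2 * lorentz (AffineMap.lineMap P Q t) (AffineMap.lineMap P Q t)
      + (lorentz Q (AffineMap.lineMap P Q t) * lorentz P R
        - lorentz P (AffineMap.lineMap P Q t) * lorentz Q R) ^ 2 := by
  rw [AffineMap.lineMap_apply_module]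
  simp only [gram, lorentz, det₃, Complex.add_re, Complex.add_im, Complex.real_smul,
    Complex.re_ofReal_mul, Complex.im_ofReal_mul]
  ring

/-- The foot of the perpendicular from `R` to the line `PQ` exists in the disk. -/
theorem exists_foot (hP : ‖P‖ < 1) (hPQ : P ≠ Q) (hR : ‖R‖ < 1) :
    ∃ t : ℝ, ‖AffineMap.lineMap P Q t‖ < 1 ∧
      lorentz Q (AffineMap.lineMap P Q t) * lorentz P R
        - lorentz P (AffineMap.lineMap P Q t) * lorentz Q R = 0 := by
  -- Up to scaling, `a (P, 1) + b (Q, 1)` is the orthogonal projection of `(R, 1)`.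
  set a := lorentz P R * lorentz Q Q - lorentz Q R * lorentz P Q with ha
  set b := lorentz Q R * lorentz P P - lorentz P R * lorentz P Q with hb
  have hN := gram_pos hP hPQ
  have hR' := lorentz_self_pos hR
  have key : (a + b) ^ 2 - ((a * P.re + b * Q.re) ^ 2 + (a * P.im + b * Q.im) ^ 2)
      = gram P Q ^ 2 * lorentz R R + gram P Q * det₃ P Q R ^ 2 := by
    simp only [ha, hb, gram, lorentz, det₃]
    ring
  have hpos : 0 < gram P Q ^ 2 * lorentz R R + gram P Q * det₃ P Q R ^ 2 := by positivity
  have hab : a + b ≠ 0 := by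
    intro h
    rw [h] at key
    nlinarith [sq_nonneg (a * P.re + b * Q.re), sq_nonneg (a * P.im + b * Q.im)]
  refine ⟨b / (a + b), ?_, ?_⟩
  · rw [← lorentz_self_pos_iff]
    rw [← key] at hpos
    have e : lorentz (AffineMap.lineMap P Q (b / (a + b))) (AffineMap.lineMap P Q (b / (a + b)))
        = ((a + b) ^ 2 - ((a * P.re + b * Q.re) ^ 2 + (a * P.im + b * Q.im) ^ 2))
          / (a + b) ^ 2 := by
      rw [AffineMap.lineMap_apply_module]
      simp only [lorentz, Complex.add_re, Complex.add_im, Complex.real_smul,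
        Complex.re_ofReal_mul, Complex.im_ofReal_mul]
      field_simp
      ring
    rw [e]
    positivity
  · have e : ∀ X : ℂ, lorentz X (AffineMap.lineMap P Q (b / (a + b))) * (a + b)
        = a * lorentz X P + b * lorentz X Q := by
      intro X
      rw [AffineMap.lineMap_apply_module]
      simp only [lorentz, Complex.add_re, Complex.add_im, Complex.real_smul,
        Complex.re_ofReal_mul, Complex.im_ofReal_mul]
      field_simp
      ring
    have hc : lorentz Q P = lorentz P Q := by unfold lorentz; ring
    apply mul_right_cancel₀ hab
    rw [zero_mul, sub_mul, mul_right_comm, mul_right_comm _ (lorentz Q R), e, e, ha, hb, hc]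
    ring

/-- The distance condition says that the trace of the normalized product of the half-turns about
the vertices is less than `2` in absolute value. -/
theorem deltaKlein_lt_DeltaKlein_iff (hP : ‖P‖ < 1) (hQ : ‖Q‖ < 1) (hPQ : P ≠ Q) (hR : ‖R‖ < 1) :
    deltaKlein P Q R < DeltaKlein P Q ↔
      det₃ P Q R ^ 2 < lorentz P P * lorentz Q Q * lorentz R R := by
  constructor
  · intro h
    unfold deltaKlein at h
    obtain ⟨_, ⟨S, ⟨hSl, hSb⟩, rfl⟩, hlt⟩ := exists_lt_of_csInf_lt
      ((show {S : ℂ | S ∈ line[ℝ, P, Q] ∧ S ∈ Metric.ball (0 : ℂ) 1}.Nonempty from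
        ⟨P, left_mem_affineSpan_pair ℝ P Q, by simpa using hP⟩).image _) h
    obtain ⟨t, rfl⟩ := mem_affineSpan_pair_iff_exists_lineMap_eq.1 hSl
    have hS : ‖AffineMap.lineMap P Q t‖ < 1 := by simpa using hSb
    rw [kleinDist_lt_DeltaKlein_iff hP hQ hPQ hR hS, gram_mul_gram_lineMap] at hlt
    have hS' := lorentz_self_pos hS
    generalize (AffineMap.lineMap P Q t : ℂ) = S at *
    refine lt_of_mul_lt_mul_right ?_ hS'.le
    nlinarith [sq_nonneg (lorentz Q S * lorentz P R - lorentz P S * lorentz Q R)]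
  · intro h
    obtain ⟨t, hS, h0⟩ := exists_foot hP hPQ hR
    have hlt : kleinDist R (AffineMap.lineMap P Q t) < DeltaKlein P Q := by
      rw [kleinDist_lt_DeltaKlein_iff hP hQ hPQ hR hS, gram_mul_gram_lineMap, h0]
      nlinarith [mul_lt_mul_of_pos_right h (lorentz_self_pos hS)]
    refine lt_of_le_of_lt (csInf_le ⟨0, ?_⟩ ⟨_, ⟨?_, ?_⟩, rfl⟩) hlt
    · rintro _ ⟨S, ⟨-, hSb⟩, rfl⟩
      exact kleinDist_nonneg hR (by simpa using hSb)
    · exact AffineMap.lineMap_mem_affineSpan_pair t P Q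
    · simpa using hS

end distance

end

end BarBilliard

theorem theorem4p2 (P Q R : ℂ) (hP : P ∈ Metric.ball (0 : ℂ) 1) (hQ : Q ∈ Metric.ball (0 : ℂ) 1)
    (hR : R ∈ Metric.ball (0 : ℂ) 1) (hPQR : AffineIndependent ℝ ![P, Q, R]) :
    (∀ v : Circle, BarBilliard.IsCcwTangentPoint P Q R v (BarBilliard.barBilliard P Q R v)) ∧
    IsHomeomorph (BarBilliard.barBilliard P Q R) ∧
    (∃ F : CircleDeg1Lift, BarBilliard.IsNormalizedLift F (BarBilliard.barBilliard P Q R)) ∧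
    (BarBilliard.deltaKlein P Q R < BarBilliard.DeltaKlein P Q →
      1 / 3 < BarBilliard.rotationNumber (BarBilliard.barBilliard P Q R) ∧
      BarBilliard.rotationNumber (BarBilliard.barBilliard P Q R) < 1 / 2) ∧
    (BarBilliard.DeltaKlein P Q ≤ BarBilliard.deltaKlein P Q R →
      BarBilliard.rotationNumber (BarBilliard.barBilliard P Q R) = 1 / 3) := by
  rw [mem_ball_zero_iff] at hP hQ hR
  have hPQ : P ≠ Q := fun h => by
    have := hPQR.injective (a₁ := 0) (a₂ := 1) (by simpa using h)
    simp at this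
  have hi := BarBilliard.interior_triangle_nonempty hPQR
  have hV : ∀ X ∈ ({P, Q, R} : Set ℂ), ‖X‖ < 1 := by
    rintro X (rfl | rfl | rfl) <;> assumption
  have hF := BarBilliard.isNormalizedLift_tangentDeg1Lift hV hi
  rw [hF.rotationNumber_eq]
  refine ⟨fun v => ?_, BarBilliard.isHomeomorph_barBilliard hV hi, ⟨_, hF⟩, fun h => ⟨?_,
    BarBilliard.translationNumber_tangentDeg1Lift_lt hV hi⟩, fun h => ?_⟩
  · obtain ⟨x, rfl⟩ := BarBilliard.turn_surjective v
    rw [BarBilliard.barBilliard_turn_eq hV hi]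
    exact BarBilliard.isCcwTangentPoint_turn hV hi (BarBilliard.isLeast_tangentLift P Q R x)
  · rw [BarBilliard.deltaKlein_lt_DeltaKlein_iff hP hQ hPQ hR] at h
    refine BarBilliard.one_third_lt_translationNumber hV
      fun X hX Y hY Z hZ hXY hYZ hXZ x hfix => h.not_ge ?_
    -- The determinant changes at most its sign when the vertices are permuted.
    have hdet := BarBilliard.le_det₃_sq_of_fixed (hV Z hZ) (hV Y hY) (hV X hX) hfix
    unfold BarBilliard.det₃ at hdet ⊢
    rcases hX with rfl | rfl | rfl <;> rcases hY with rfl | rfl | rfl <;>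
      first
      | exact absurd rfl hXY
      | rcases hZ with rfl | rfl | rfl <;>
          first
          | exact absurd rfl hXZ
          | exact absurd rfl hYZ
          | linarith
  · rw [← not_lt, BarBilliard.deltaKlein_lt_DeltaKlein_iff hP hQ hPQ hR, not_lt] at h
    obtain ⟨x, hx⟩ := BarBilliard.exists_fixed_of_le_det₃_sq hP hQ hR h
    exact le_antisymm (BarBilliard.translationNumber_le_one_third hV hx)
      (BarBilliard.one_third_le_translationNumber hV)
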